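/- **Setting.** Let $n\ge 1$. A *region* of $\mathbb R^n$ is a nonempty connected open set together with none, some or all of its boundary points. For $K\subseteq\mathbb R^n$ and a piecewise linear $f\colon K\to\mathbb R^{k}$, a *linear region* of $f$ is a region $D\subseteq K$ on which $f$ is affine and which is not properly contained in another region $D'\subseteq K$ on which $f$ is affine. Two linear regions $D,D'$ of $f$ (with the functions $f|_D,f|_{D'}$) are *equivalent* if there is a Euclidean transformation $\phi(x)=Ax+b$, $A$ orthogonal, with $\phi(D)=D'$ and $f|_D=f|_{D'}\circ\phi|_D$. Let $c^\sim(f)$ be the number of equivalence classes and, for a set $\mathcal H$ of such functions, $c^\sim(\mathcal H)=\max_{f\in\mathcal H}c^\sim(f)$. Let $S_n$ act on $(\mathbb R^n)^a$ by permuting the coordinates of each of the $a$ vectors. For $L\ge 1$ and $\underline m=(m_1,\dots,m_L,m_{L+1})$ with all $m_i\ge 1$, let $\mathcal H^{\rm inv}_{[0,1]^n}(n,\underline m)$ be the set of restrictions to $[0,1]^n$ of the deep set models $f_{L+1}\circ\mathrm{ReLU}\circ f_L\circ\cdots\circ\mathrm{ReLU}\circ f_1$, where $f_i\colon(\mathbb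 R^n)^{m_{i-1}}\to(\mathbb R^n)^{m_i}$ ($1\le i\le L$, $m_0=1$) are $S_n$-equivariant affine maps and $f_{L+1}\colon(\mathbb R^n)^{m_L}\to\mathbb R^{m_{L+1}}$ is an $S_n$-invariant affine map. **Theorem.** The maximum $c^\sim(\mathcal H^{\rm inv}_{[0,1]^n}(n,\underline m))$ exists and is finite, and for every fixed $n\ge1$ $$c^{\sim}(\mathcal H^{\rm inv}_{[0,1]^n}(n,\underline m))=\Omega\Big((m_1\cdots m_L)^n\frac{n^n}{n!}\Big)=\Omega\Big(\frac{(m_1\cdots m_L\,e)^n}{\sqrt n}\Big).$$ That is, for each of the two bounds there is a constant $C=C(n)>0$, depending on $n$ only (not on $L$ or on $m_1,\dots,m_{L+1}$), such that the left side is at least $C$ times the bound for all $L\ge1$ and all $\underline m$ as above. The two bounds agree up to absolute constants: there are $c_1,c_2>0$ with $c_1\frac{(Me)^n}{\sqrt n}\le M^n\frac{n^n}{n!}\le c_2\frac{(Me)^n}{\sqrt n}$ for all integers $n\ge1$, $M\ge0$. Moreover, the shallow invariant model with one hidden layer $(\mathbb R^n)^{s}$, $s=m_1+\cdots+m_L$,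 that is, with the same number $ns$ of hidden units, satisfies, for fixed $n$ and uniformly in $L$ and $\underline m$, $$c^\sim(\mathcal H^{\rm inv}_{[0,1]^n}(n,(s,m_{L+1})))=\Theta\Big(\frac{(s\,e)^n}{\sqrt n}\Big),$$ and the deep model is exponentially more complex: for every $n\ge1$ there is $C=C(n)>0$ such that for all $L\ge1$ and all $\underline m$ as above $$c^{\sim}(\mathcal H^{\rm inv}_{[0,1]^n}(n,\underline m))\ \ge\ C\Big(\frac{m_1\cdots m_L}{m_1+\cdots+m_L}\Big)^n c^\sim(\mathcal H^{\rm inv}_{[0,1]^n}(n,(s,m_{L+1}))),$$ and, whenever $w\ge2$ is an integer and $m_1,\dots,m_L\ge w$, $$c^{\sim}(\mathcal H^{\rm inv}_{[0,1]^n}(n,\underline m))\ \ge\ C\Big(\frac{w^{L-1}}{L}\Big)^n c^\sim(\mathcal H^{\rm inv}_{[0,1]^n}(n,(s,m_{L+1}))).$$ -/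

import Mathlib

/-! ### Linear regions and the measure of complexity -/

/-- `ℝⁿ` with the Euclidean distance. -/
abbrev Euc (n : ℕ) : Type := EuclideanSpace ℝ (Fin n)

/-- A region of `ℝⁿ`: a nonempty connected open set together with none, some or all of its
boundary points. -/
def IsRegion {n : ℕ} (D : Set (Euc n)) : Prop :=
  ∃ U : Set (Euc n), IsOpen U ∧ IsConnected U ∧ U ⊆ D ∧ D ⊆ closure U

/-- `f : K → ℝᵏ` is linear (that is, affine) on `D`. -/
def LinearOn {n k : ℕ} {K : Set (Euc n)} (f : K → (Fin k → ℝ)) (D : Set (Euc n)) : Prop :=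
  ∃ l : Euc n →ᵃ[ℝ] (Fin k → ℝ), ∀ x : K, (x : Euc n) ∈ D → f x = l x

/-- `D` is a linear region of `f : K → ℝᵏ`: a region contained in `K` on which `f` is linear,
and which is maximal with this property. -/
def IsLinearRegion {n k : ℕ} {K : Set (Euc n)} (f : K → (Fin k → ℝ)) (D : Set (Euc n)) : Prop :=
  IsRegion D ∧ D ⊆ K ∧ LinearOn f D ∧
    ∀ D' : Set (Euc n), IsRegion D' → D' ⊆ K → D ⊂ D' → ¬ LinearOn f D'

/-- The set `𝓕(f)` of linear functions of `f`. A pair `(f_λ, D_λ)` is recorded by its linear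
region `D_λ`, since `f_λ` is the restriction of `f` to `D_λ`. -/
abbrev LinearPieces {n k : ℕ} {K : Set (Euc n)} (f : K → (Fin k → ℝ)) : Type :=
  {D : Set (Euc n) // IsLinearRegion f D}

/-- `(f|_D, D) ∼ (f|_D', D')`: there is a Euclidean transformation `φ` of `ℝⁿ` (an isometric
affine bijection) with `φ(D) = D'` and `f|_D = f|_D' ∘ φ|_D`. -/
def PieceEquiv {n k : ℕ} {K : Set (Euc n)} (f : K → (Fin k → ℝ)) (D D' : Set (Euc n)) : Prop :=
  ∃ φ : Euc n ≃ᵃⁱ[ℝ] Euc n, φ '' D = D' ∧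
    ∀ x y : K, (x : Euc n) ∈ D → (y : Euc n) = φ x → f x = f y

/-- `∼` as an equivalence relation on `𝓕(f)`. -/
def pieceSetoid {n k : ℕ} {K : Set (Euc n)} (f : K → (Fin k → ℝ)) : Setoid (LinearPieces f) where
  r D D' := PieceEquiv f D.1 D'.1
  iseqv :=
    { refl := fun D => ⟨AffineIsometryEquiv.refl ℝ (Euc n), by simp, by
        intro x y _ h
        exact congrArg f (Subtype.ext (by simpa using h.symm))⟩
      symm := by
        rintro ⟨D, hD⟩ ⟨D', hD'⟩ ⟨φ, h1, h2⟩
        refine ⟨φ.symm, ?_, ?_⟩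
        · subst h1
          ext z
          simp
        · intro x y hx hxy
          refine (h2 y x ?_ ?_).symm
          · have h1' : φ '' D = D' := h1
            have hx' : (x : Euc n) ∈ D' := hx
            rw [← h1'] at hx'
            obtain ⟨z, hz, hzx⟩ := hx'
            change (y : Euc n) ∈ D
            rw [hxy, ← hzx]
            simpa using hz
          · rw [hxy]
            simp
      trans := by
        rintro ⟨D, hD⟩ ⟨D', hD'⟩ ⟨D'', hD''⟩ ⟨φ, h1, h2⟩ ⟨ψ, h3, h4⟩
        refine ⟨φ.trans ψ, ?_, ?_⟩
        · change φ '' D = D' at h1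
          change ψ '' D' = D'' at h3
          change (φ.trans ψ) '' D = D''
          rw [← h3, ← h1, Set.image_image]
          rfl
        · intro x y hx hxy
          have hm : φ (x : Euc n) ∈ D' := by
            have h1' : φ '' D = D' := h1
            rw [← h1']
            exact Set.mem_image_of_mem _ hx
          have hK : φ (x : Euc n) ∈ K := hD'.2.1 hm
          exact (h2 x ⟨_, hK⟩ hx rfl).trans (h4 ⟨_, hK⟩ y hm hxy) }

/-- `c^∼(f)`: the number of equivalence classes of linear functions of `f`. -/
noncomputable def complexity {n k : ℕ} {K : Set (Euc n)} (f : K → (Fin k → ℝ)) : ℕ∞ :=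
  ENat.card (Quotient (pieceSetoid f))

/-- `c^∼(𝓗)`: the maximum of `c^∼(f)` over `f ∈ 𝓗` (a supremum in `ℕ ∪ {∞}`; that it is finite
and attained is claimed where it is used). -/
noncomputable def classComplexity {n k : ℕ} {K : Set (Euc n)} (H : Set (K → (Fin k → ℝ))) : ℕ∞ :=
  ⨆ f ∈ H, complexity f

/-! ### Deep set models -/

/-- The feature space `(ℝⁿ)ᵃ`; `X i j` is the `j`-th coordinate of the `i`-th vector. -/
abbrev Feat (n a : ℕ) : Type := Fin a → Fin n → ℝ

/-- The action of `Sₙ` on `(ℝⁿ)ᵃ`, permuting the coordinates of each of the `a` vectors. -/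
def permAct {n a : ℕ} (σ : Equiv.Perm (Fin n)) (X : Feat n a) : Feat n a :=
  fun i j => X i (σ⁻¹ j)

/-- Permutation equivariance. -/
def PermEquivariant {n a b : ℕ} (f : Feat n a → Feat n b) : Prop :=
  ∀ (σ : Equiv.Perm (Fin n)) (X : Feat n a), f (permAct σ X) = permAct σ (f X)

/-- Permutation invariance. -/
def PermInvariant {n a k : ℕ} (f : Feat n a → (Fin k → ℝ)) : Prop :=
  ∀ (σ : Equiv.Perm (Fin n)) (X : Feat n a), f (permAct σ X) = f X

/-- The coordinatewise rectifier `t ↦ max(0, t)`. -/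
def reluMap {n a : ℕ} (X : Feat n a) : Feat n a :=
  fun i j => max 0 (X i j)

/-- The functions `(ℝⁿ)ᵃ → ℝᵏ` of the form `f_{L+1} ∘ ReLU ∘ f_L ∘ ⋯ ∘ ReLU ∘ f_1`, where the list
`[m_1, …, m_L]` gives the hidden widths, `f_1 : (ℝⁿ)ᵃ → (ℝⁿ)^{m_1}`, …,
`f_L : (ℝⁿ)^{m_{L-1}} → (ℝⁿ)^{m_L}` are permutation equivariant affine maps and
`f_{L+1} : (ℝⁿ)^{m_L} → ℝᵏ` is a permutation invariant affine map. -/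
def deepSetFrom (n k : ℕ) : (a : ℕ) → List ℕ → Set (Feat n a → (Fin k → ℝ))
  | a, [] => {g | ∃ f : Feat n a →ᵃ[ℝ] (Fin k → ℝ), PermInvariant f ∧ g = f}
  | a, b :: m => {g | ∃ f : Feat n a →ᵃ[ℝ] Feat n b, PermEquivariant f ∧
      ∃ h ∈ deepSetFrom n k b m, g = fun X => h (reluMap (f X))}

/-- The cube `[0,1]ⁿ`. -/
def unitCube (n : ℕ) : Set (Euc n) := {x | ∀ j, x j ∈ Set.Icc (0 : ℝ) 1}

/-- The set `𝓗^inv_{[0,1]ⁿ}(n, (m_1, …, m_L, k))` of the restrictions to `[0,1]ⁿ` of the deep set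
models with input `ℝⁿ = (ℝⁿ)¹`, hidden layers `(ℝⁿ)^{m_1}, …, (ℝⁿ)^{m_L}` and output `ℝᵏ`. -/
def deepSetModels (n : ℕ) (m : List ℕ) (k : ℕ) : Set (unitCube n → (Fin k → ℝ)) :=
  {f | ∃ F ∈ deepSetFrom n k 1 m, ∀ x : unitCube n, f x = F (fun _ j => (x : Euc n) j)}

/-- `c^∼(𝓗^inv_{[0,1]ⁿ}(n, (m_1, …, m_L, k)))`. -/
noncomputable def deepSetComplexity (n : ℕ) (m : List ℕ) (k : ℕ) : ℕ∞ :=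
  classComplexity (deepSetModels n m k)

/-! ### Linear regions of continuous functions on a closed set -/

/-! Write M for the product of the hidden widths.

Lower bound. Equivalent linear regions carry affine maps whose gradients have the same norm, so it
suffices to build one model with many gradient norms. A layer of width p can realize,
coordinatewise, a zigzag on an interval whose p pieces have absolute slopes 1, b, ..., b^(p-1) and
each map onto the whole range. Feeding it into a model of the same kind with base b^p multiplies
slopes, so the layers produce every absolute slope b^e with e < M
(`exists_separable_mem_deepSetFrom`). Summing over coordinates gives x ↦ ∑ h(T x_j), which is affine
on boxes, with squared gradient norm T^2 ∑ b^(2 e_j). For b = n + 1 this sum is a base b^2 expansion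
whose digits are the multiplicities of the exponents, so it determines the multiset of the e_j.
Hence there are at least as many classes as multisets of size n from M kinds, which is at least M^n
/ n! (`card_sym_le_deepSetComplexity`).

Upper bound. Where the activation pattern is fixed, the model is affine on a convex cell, and there
are at most as many linear regions as cells (`card_linearPieces_le`). This gives finiteness at every
depth. For one hidden layer the cells are sign patterns of sn affine functions on an n-dimensional
space; they have VC dimension at most n, so by Sauer–Shelah there are O(s^n) of them
(`card_signPatterns_le`).

For fixed n all remaining factors are constants; Stirling's formula relates n^n / n! to e^n / √n. -/

theorem AffineMap.eq_of_eqOn_isOpen {n k : ℕ} {l l' : Euc n →ᵃ[ℝ] (Fin k → ℝ)} {U : Set (Euc n)}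
    (hU : IsOpen U) (hne : U.Nonempty) (h : ∀ x ∈ U, l x = l' x) : l = l' :=
  AffineMap.ext_on (hU.affineSpan_eq_top hne) h

/-- The set of points of `K` at which `f` agrees with the affine map `l`. -/
def agreeSet {n k : ℕ} {K : Set (Euc n)} (f : K → (Fin k → ℝ)) (l : Euc n →ᵃ[ℝ] (Fin k → ℝ)) :
    Set (Euc n) :=
  {x | ∃ h : x ∈ K, f ⟨x, h⟩ = l x}

theorem isClosed_agreeSet {n k : ℕ} {K : Set (Euc n)} (hK : IsClosed K) {f : K → (Fin k → ℝ)}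
    (hf : Continuous f) (l : Euc n →ᵃ[ℝ] (Fin k → ℝ)) : IsClosed (agreeSet f l) := by
  have h1 : IsClosed {x : K | f x = l x} :=
    isClosed_eq hf (l.continuous_of_finiteDimensional.comp continuous_subtype_val)
  have h2 := hK.isClosedEmbedding_subtypeVal.isClosedMap _ h1
  convert h2 using 1
  ext x
  simp [agreeSet]

theorem linearOn_of_subset_agreeSet {n k : ℕ} {K : Set (Euc n)} {f : K → (Fin k → ℝ)}
    {l : Euc n →ᵃ[ℝ] (Fin k → ℝ)} {D : Set (Euc n)} (h : D ⊆ agreeSet f l) : LinearOn f D :=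
  ⟨l, fun _ hx => (h hx).2⟩

theorem linearOn_iff_exists_subset_agreeSet {n k : ℕ} {K : Set (Euc n)} {f : K → (Fin k → ℝ)}
    {D : Set (Euc n)} (hD : D ⊆ K) : LinearOn f D ↔ ∃ l, D ⊆ agreeSet f l :=
  ⟨fun ⟨l, hl⟩ => ⟨l, fun x hx => ⟨hD hx, hl ⟨x, hD hx⟩ hx⟩⟩,
    fun ⟨_, hl⟩ => linearOn_of_subset_agreeSet hl⟩

theorem IsRegion.closure_of_isOpen {n : ℕ} {U : Set (Euc n)} (hU : IsOpen U)
    (hc : IsConnected U) : IsRegion (closure U) :=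
  ⟨U, hU, hc, subset_closure, subset_rfl⟩

/-- A connected open set on which `f` is affine is contained in a linear region of `f`. -/
theorem exists_isLinearRegion_of_subset_agreeSet {n k : ℕ} {K : Set (Euc n)} (hK : IsClosed K)
    {f : K → (Fin k → ℝ)} (hf : Continuous f) {l : Euc n →ᵃ[ℝ] (Fin k → ℝ)} {U : Set (Euc n)}
    (hU : IsOpen U) (hc : IsConnected U) (hl : U ⊆ agreeSet f l) :
    ∃ D, IsLinearRegion f D ∧ U ⊆ D ∧ D ⊆ agreeSet f l := by
  obtain ⟨x, hx⟩ := hc.nonempty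
  have hUW : U ⊆ interior (agreeSet f l) := interior_maximal hl hU
  set V := connectedComponentIn (interior (agreeSet f l)) x with hV
  have hVo : IsOpen V := isOpen_interior.connectedComponentIn
  have hVc : IsConnected V := isConnected_connectedComponentIn_iff.2 (hUW hx)
  have hVl : closure V ⊆ agreeSet f l :=
    closure_minimal ((connectedComponentIn_subset _ _).trans interior_subset)
      (isClosed_agreeSet hK hf l)
  have hUV : U ⊆ V := hc.isPreconnected.subset_connectedComponentIn hx hUW
  have hAK : agreeSet f l ⊆ K := fun y hy => hy.1
  refine ⟨closure V, ⟨IsRegion.closure_of_isOpen hVo hVc, hVl.trans hAK,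
    linearOn_of_subset_agreeSet hVl, ?_⟩, hUV.trans subset_closure, hVl⟩
  rintro D' ⟨U', hU'o, hU'c, hU'D, hDU'⟩ hD'K hss hlin
  obtain ⟨l', hl'⟩ := (linearOn_iff_exists_subset_agreeSet hD'K).1 hlin
  have hll : l' = l := AffineMap.eq_of_eqOn_isOpen hVo hVc.nonempty fun y hy =>
    (hl' (hss.1 (subset_closure hy))).2.symm.trans (hVl (subset_closure hy)).2
  subst hll
  have hx' : x ∈ V := hUV hx
  -- `D'` lies in the closure of `U'`, so the open set `V` meets `U'`; the component `V` then
  -- absorbs all of `U'`, contradicting strictness.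
  have hmeet : (V ∩ U').Nonempty :=
    mem_closure_iff.1 (hDU' (hss.1 (subset_closure hx'))) V hVo hx'
  have hu : IsPreconnected (V ∪ U') :=
    hVc.isPreconnected.union' hmeet hU'c.isPreconnected
  have : V ∪ U' ⊆ V := hu.subset_connectedComponentIn (Or.inl hx')
    (Set.union_subset (connectedComponentIn_subset _ _)
      (interior_maximal (hU'D.trans hl') hU'o))
  exact hss.2 (hDU'.trans (closure_mono (Set.subset_union_right.trans this)))

/-- A function that is affine on each of finitely many convex sets covering a closed convex set
has at most as many linear regions as there are convex sets. -/
theorem card_linearPieces_le {n k : ℕ} {K : Set (Euc n)} (hK : IsClosed K) (hKc : Convex ℝ K)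
    {f : K → (Fin k → ℝ)} (hf : Continuous f) {ι : Type*} [Finite ι] (C : ι → Set (Euc n))
    (hC : ∀ i, Convex ℝ (C i)) (hcov : K ⊆ ⋃ i, C i) (hlin : ∀ i, LinearOn f (C i)) :
    ENat.card (LinearPieces f) ≤ ENat.card ι := by
  choose l hl using hlin
  let E : ι → Set (Euc n) := fun i => closure (C i ∩ K)
  have hEA : ∀ i, E i ⊆ agreeSet f (l i) := fun i =>
    closure_minimal (fun x hx => ⟨hx.2, hl i ⟨x, hx.2⟩ hx.1⟩) (isClosed_agreeSet hK hf _)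
  have hKE : ∀ x ∈ K, ∃ i, x ∈ E i := fun x hx => by
    obtain ⟨i, hi⟩ := Set.mem_iUnion.1 (hcov hx)
    exact ⟨i, subset_closure ⟨hi, hx⟩⟩
  have hEc : ∀ i, Convex ℝ (interior (E i)) := fun i => ((hC i).inter hKc).closure.interior
  -- Baire: the closed cells together with the complement of `U` (the index `none`) cover the space,
  -- so some cell has interior points in `U`.
  have key : ∀ D : LinearPieces f, ∃ i, ∃ U : Set (Euc n), IsOpen U ∧ IsConnected U ∧ U ⊆ D.1 ∧
      D.1 ⊆ closure U ∧ (U ∩ interior (E i)).Nonempty := by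
    rintro ⟨D, ⟨U, hUo, hUc, hUD, hDU⟩, hDK, -, -⟩
    have hd : Dense (⋃ o : Option ι, interior (o.elim Uᶜ E)) := by
      refine dense_iUnion_interior_of_closed (fun o => ?_) ?_
      · cases o with
        | none => exact hUo.isClosed_compl
        | some i => exact isClosed_closure
      · refine Set.eq_univ_of_forall fun x => ?_
        by_cases hx : x ∈ U
        · obtain ⟨i, hi⟩ := hKE x (hDK (hUD hx))
          exact Set.mem_iUnion.2 ⟨some i, hi⟩
        · exact Set.mem_iUnion.2 ⟨none, hx⟩
    obtain ⟨x, hxU, hx⟩ := hd.inter_open_nonempty U hUo hUc.nonempty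
    obtain ⟨o, ho⟩ := Set.mem_iUnion.1 hx
    cases o with
    | none => exact absurd hxU (interior_subset ho)
    | some i => exact ⟨i, U, hUo, hUc, hUD, hDU, x, hxU, ho⟩
  choose i U hUo hUc hUD hDU hne using key
  refine ENat.card_le_card_of_injective (f := i) fun D₁ D₂ h12 => ?_
  have hagree : ∀ D : LinearPieces f, D.1 ⊆ agreeSet f (l (i D)) := fun D => by
    obtain ⟨l', hl'⟩ := (linearOn_iff_exists_subset_agreeSet D.2.2.1).1 D.2.2.2.1
    have : l' = l (i D) := AffineMap.eq_of_eqOn_isOpen ((hUo D).inter isOpen_interior) (hne D)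
      fun y hy => (hl' (hUD D hy.1)).2.symm.trans (hEA _ (interior_subset hy.2)).2
    exact this ▸ hl'
  -- Two regions meeting the interior of the same cell share its affine map. The convex set `O`
  -- joins their open cores, so the closure of the union is again a region of affinity; by
  -- maximality both equal it.
  set O := interior (E (i D₁)) with hO
  have hne2 : (U D₂ ∩ O).Nonempty := by rw [hO, h12]; exact hne D₂
  have hW : IsConnected (U D₁ ∪ O ∪ U D₂) := by
    have hOc : IsConnected O := (hEc _).isConnected ((hne D₁).mono Set.inter_subset_right)
    refine IsConnected.union ?_ (IsConnected.union (hne D₁) (hUc D₁) hOc) (hUc D₂)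
    obtain ⟨y, hy2, hyO⟩ := hne2
    exact ⟨y, Or.inr hyO, hy2⟩
  have hWo : IsOpen (U D₁ ∪ O ∪ U D₂) := ((hUo D₁).union isOpen_interior).union (hUo D₂)
  have hWA : closure (U D₁ ∪ O ∪ U D₂) ⊆ agreeSet f (l (i D₁)) := by
    refine closure_minimal ?_ (isClosed_agreeSet hK hf _)
    refine Set.union_subset (Set.union_subset ((hUD D₁).trans (hagree D₁))
      (interior_subset.trans (hEA _))) ?_
    rw [h12]
    exact (hUD D₂).trans (hagree D₂)
  have hmax : ∀ D : LinearPieces f, D.1 ⊆ closure (U D₁ ∪ O ∪ U D₂) →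
      D.1 = closure (U D₁ ∪ O ∪ U D₂) := fun D hD => by
    by_contra hne'
    exact D.2.2.2.2 _ (IsRegion.closure_of_isOpen hWo hW) (fun y hy => (hWA hy).1)
      (hD.ssubset_of_ne hne') (linearOn_of_subset_agreeSet hWA)
  refine Subtype.ext ((hmax D₁ ?_).trans (hmax D₂ ?_).symm)
  · exact (hDU D₁).trans (closure_mono (Set.subset_union_left.trans Set.subset_union_left))
  · exact (hDU D₂).trans (closure_mono Set.subset_union_right)

theorem complexity_le_card_linearPieces {n k : ℕ} {K : Set (Euc n)} (f : K → (Fin k → ℝ)) :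
    complexity f ≤ ENat.card (LinearPieces f) :=
  ENat.card_le_card_of_injective Quotient.out_injective

/-! ### Deep set models are piecewise affine -/

theorem continuous_reluMap {n a : ℕ} : Continuous (reluMap : Feat n a → Feat n a) :=
  continuous_pi fun i => continuous_pi fun j =>
    continuous_const.max ((continuous_apply j).comp (continuous_apply i))

theorem continuous_of_mem_deepSetFrom {n k : ℕ} {m : List ℕ} :
    ∀ {a : ℕ} {F : Feat n a → (Fin k → ℝ)}, F ∈ deepSetFrom n k a m → Continuous F := by
  induction m with
  | nil =>
    rintro a _ ⟨f, -, rfl⟩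
    exact f.continuous_of_finiteDimensional
  | cons b m ih =>
    rintro a _ ⟨f, -, h, hh, rfl⟩
    exact (ih hh).comp (continuous_reluMap.comp f.continuous_of_finiteDimensional)

open Classical in
/-- The set of coordinates at which the rectifier is active. -/
noncomputable def activePattern {n a : ℕ} (X : Feat n a) : Finset (Fin a × Fin n) :=
  {p | 0 < X p.1 p.2}

theorem mem_activePattern {n a : ℕ} {X : Feat n a} {p : Fin a × Fin n} :
    p ∈ activePattern X ↔ 0 < X p.1 p.2 := by simp [activePattern]

theorem convex_setOf_activePattern_eq {n a : ℕ} (s : Finset (Fin a × Fin n)) :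
    Convex ℝ {X : Feat n a | activePattern X = s} := by
  intro X hX Y hY u v hu hv huv
  have hXY : activePattern X = activePattern Y := Eq.trans hX hY.symm
  refine Eq.trans ?_ hX
  ext p
  have hiff : 0 < X p.1 p.2 ↔ 0 < Y p.1 p.2 := by
    rw [← mem_activePattern, ← mem_activePattern, hXY]
  rw [mem_activePattern, mem_activePattern]
  simp only [Pi.add_apply, Pi.smul_apply, smul_eq_mul]
  by_cases h : 0 < X p.1 p.2
  · refine iff_of_true ?_ h
    have h' := hiff.1 h
    rcases hu.eq_or_lt with rfl | hu'
    · have : v = 1 := by linarith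
      simpa [this] using h'
    · have := mul_pos hu' h
      have := mul_nonneg hv h'.le
      linarith
  · refine iff_of_false ?_ h
    have h' : Y p.1 p.2 ≤ 0 := not_lt.1 (hiff.not.1 h)
    have := mul_nonpos_of_nonneg_of_nonpos hu (not_lt.1 h)
    have := mul_nonpos_of_nonneg_of_nonpos hv h'
    linarith

open Classical in
/-- The linear map that keeps the coordinates in `s` and annihilates the others. -/
noncomputable def maskMap {n a : ℕ} (s : Finset (Fin a × Fin n)) : Feat n a →ₗ[ℝ] Feat n a where
  toFun X i j := if (i, j) ∈ s then X i j else 0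
  map_add' X Y := by ext i j; simp only [Pi.add_apply]; split_ifs <;> simp
  map_smul' c X := by ext i j; simp

theorem reluMap_eq_maskMap {n a : ℕ} (X : Feat n a) : reluMap X = maskMap (activePattern X) X := by
  ext i j
  simp only [reluMap, maskMap, LinearMap.coe_mk, AddHom.coe_mk, mem_activePattern]
  split_ifs with h
  · exact max_eq_right h.le
  · exact max_eq_left (not_lt.1 h)

/-- The number of affine pieces of a deep set model is bounded in terms of its widths. -/
theorem exists_convex_cells_of_mem_deepSetFrom (n : ℕ) (m : List ℕ) :
    ∃ N : ℕ, ∀ (k a : ℕ) (F : Feat n a → (Fin k → ℝ)), F ∈ deepSetFrom n k a m →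
      ∃ C : Fin N → Set (Feat n a), (∀ i, Convex ℝ (C i)) ∧ (⋃ i, C i = Set.univ) ∧
        ∀ i, ∃ l : Feat n a →ᵃ[ℝ] (Fin k → ℝ), Set.EqOn F l (C i) := by
  induction m with
  | nil =>
    refine ⟨1, ?_⟩
    rintro k a _ ⟨f, -, rfl⟩
    exact ⟨fun _ => Set.univ, fun _ => convex_univ, Set.iUnion_const _, fun _ => ⟨f, fun _ _ => rfl⟩⟩
  | cons b m ih =>
    obtain ⟨N, hN⟩ := ih
    -- A cell is a pattern of the first layer together with a cell of the remaining layers.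
    refine ⟨Fintype.card (Finset (Fin b × Fin n) × Fin N), ?_⟩
    rintro k a _ ⟨f, -, h, hh, rfl⟩
    obtain ⟨C, hC, hcov, hl⟩ := hN k b h hh
    choose l hl using hl
    let e := (Fintype.equivFin (Finset (Fin b × Fin n) × Fin N)).symm
    refine ⟨fun q => f ⁻¹' {Y | activePattern Y = (e q).1} ∩
      ((maskMap (e q).1).toAffineMap.comp f) ⁻¹' C (e q).2, fun q => ?_, ?_, fun q => ?_⟩
    · exact ((convex_setOf_activePattern_eq _).affine_preimage f).inter
        ((hC _).affine_preimage _)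
    · refine Set.eq_univ_of_forall fun X => ?_
      obtain ⟨i, hi⟩ := Set.mem_iUnion.1 (hcov.ge (Set.mem_univ (reluMap (f X))))
      refine Set.mem_iUnion.2 ⟨e.symm (activePattern (f X), i), ?_⟩
      rw [reluMap_eq_maskMap] at hi
      simpa using hi
    · refine ⟨(l (e q).2).comp ((maskMap (e q).1).toAffineMap.comp f), fun X hX => ?_⟩
      have h1 : activePattern (f X) = (e q).1 := hX.1
      have h2 : reluMap (f X) = maskMap (e q).1 (f X) := by rw [← h1, reluMap_eq_maskMap]
      have h3 : maskMap (e q).1 (f X) ∈ C (e q).2 := hX.2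
      simp only [h2, hl _ h3]
      rfl

/-- The identification of `ℝⁿ` with `(ℝⁿ)¹`. -/
noncomputable def toFeat (n : ℕ) : Euc n →ₗ[ℝ] Feat n 1 where
  toFun x _ j := x j
  map_add' _ _ := rfl
  map_smul' _ _ := rfl

theorem isClosed_unitCube (n : ℕ) : IsClosed (unitCube n) := by
  have : unitCube n = ⋂ j : Fin n, (fun x : Euc n => x j) ⁻¹' Set.Icc (0 : ℝ) 1 := by
    ext x; simp [unitCube]
  rw [this]
  exact isClosed_iInter fun j => isClosed_Icc.preimage (by fun_prop)

theorem convex_unitCube (n : ℕ) : Convex ℝ (unitCube n) :=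
  fun _ hx _ hy _ _ hu hv huv j => convex_Icc (0 : ℝ) 1 (hx j) (hy j) hu hv huv

theorem continuous_of_mem_deepSetModels {n k : ℕ} {m : List ℕ} {f : unitCube n → (Fin k → ℝ)}
    (hf : f ∈ deepSetModels n m k) : Continuous f := by
  obtain ⟨F, hF, h⟩ := hf
  have : f = fun x : unitCube n => F (toFeat n x) := funext h
  rw [this]
  exact (continuous_of_mem_deepSetFrom hF).comp
    ((toFeat n).continuous_of_finiteDimensional.comp continuous_subtype_val)

theorem exists_complexity_le (n : ℕ) (m : List ℕ) :
    ∃ N : ℕ, ∀ (k : ℕ), ∀ f ∈ deepSetModels n m k, complexity f ≤ N := by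
  obtain ⟨N, hN⟩ := exists_convex_cells_of_mem_deepSetFrom n m
  refine ⟨N, fun k f hf => ?_⟩
  have hcont := continuous_of_mem_deepSetModels hf
  obtain ⟨F, hF, h⟩ := hf
  obtain ⟨C, hC, hcov, hl⟩ := hN k 1 F hF
  refine (complexity_le_card_linearPieces f).trans ?_
  refine (card_linearPieces_le (isClosed_unitCube n) (convex_unitCube n) hcont
    (fun i => toFeat n ⁻¹' C i) (fun i => (hC i).linear_preimage _) ?_ fun i => ?_).trans
      (by simp)
  · rw [← Set.preimage_iUnion, hcov]
    exact Set.subset_univ _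
  · obtain ⟨l, hl⟩ := hl i
    exact ⟨l.comp (toFeat n).toAffineMap, fun x hx => (h x).trans (hl hx)⟩

theorem deepSetFrom_nonempty (n k : ℕ) (m : List ℕ) : ∀ a, (deepSetFrom n k a m).Nonempty := by
  induction m with
  | nil => exact fun a => ⟨_, 0, fun _ _ => rfl, rfl⟩
  | cons b m ih =>
    intro a
    obtain ⟨h, hh⟩ := ih b
    exact ⟨_, 0, fun _ _ => rfl, h, hh, rfl⟩

theorem deepSetComplexity_ne_top (n : ℕ) (m : List ℕ) (k : ℕ) : deepSetComplexity n m k ≠ ⊤ := by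
  obtain ⟨N, hN⟩ := exists_complexity_le n m
  exact ne_top_of_le_ne_top (ENat.natCast_ne_top N) (iSup₂_le (hN k))

theorem exists_complexity_eq_deepSetComplexity (n : ℕ) (m : List ℕ) (k : ℕ) :
    ∃ f ∈ deepSetModels n m k, complexity f = deepSetComplexity n m k := by
  obtain ⟨F, hF⟩ := deepSetFrom_nonempty n k m 1
  have : Nonempty (deepSetModels n m k) := ⟨⟨_, F, hF, fun _ => rfl⟩⟩
  have h : deepSetComplexity n m k = ⨆ f : deepSetModels n m k, complexity f.1 :=
    iSup_subtype'
  obtain ⟨f, hf⟩ := ENat.exists_eq_iSup_of_lt_top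
    (h ▸ (deepSetComplexity_ne_top n m k).lt_top)
  exact ⟨f.1, f.2, hf.trans h.symm⟩

/-! ### Sign patterns of affine functions and shallow models -/

section SignPatterns

variable {α E : Type*} [DecidableEq α] [AddCommGroup E] [Module ℝ E]
  [FiniteDimensional ℝ E]

/-- The sets of indices of affine functions that are positive at some common point shatter only
sets whose cardinality is at most the dimension. -/
theorem card_le_finrank_of_shatters {φ : α → E →ᵃ[ℝ] ℝ} {𝒜 : Finset (Finset α)}
    (h𝒜 : ∀ A ∈ 𝒜, ∃ x, ∀ i, i ∈ A ↔ 0 < φ i x) {s : Finset α} (hs : 𝒜.Shatters s) :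
    s.card ≤ Module.finrank ℝ E := by
  by_contra hcard
  -- More functionals than the dimension are dependent, so some nontrivial combination of the `φ i`
  -- is constant.
  have hdep : ¬ LinearIndependent ℝ (fun i : s => (φ i).linear) := fun hli => by
    have := hli.fintype_card_le_finrank
    rw [Fintype.card_coe, Module.finrank_linearMap_self] at this
    exact hcard this
  obtain ⟨c, hc, i₀, hi₀⟩ := Fintype.not_linearIndependent_iff.1 hdep
  have hconst : ∀ x, ∑ i, c i * φ i x = ∑ i, c i * φ i 0 := fun x => by
    have h1 : ∑ i, c i * (φ i).linear x = 0 := by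
      simpa using LinearMap.congr_fun hc x
    have h2 : ∀ i : s, φ i x = (φ i).linear x + φ i 0 := fun i => congrFun ((φ i).decomp) x
    simp only [fun i : s => h2 i, mul_add, Finset.sum_add_distrib]
    rw [h1, zero_add]
  -- Shattering yields a point where `φ i` is positive exactly when `d i` is. Every term is then
  -- nonnegative, which excludes a negative constant, and also the constant 0 once some `d i` is
  -- positive. Replacing `c` by `-c` covers all signs.
  have key : ∀ (d : s → ℝ) (γ : ℝ), (∀ x, ∑ i, d i * φ i x = γ) → γ ≤ 0 →
      (γ = 0 → ∃ i, 0 < d i) → False := by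
    intro d γ hd hγ hpos
    obtain ⟨A, hA, hsA⟩ := hs (t := s.filter fun i => ∃ h : i ∈ s, 0 < d ⟨i, h⟩)
      (Finset.filter_subset _ _)
    obtain ⟨x, hx⟩ := h𝒜 A hA
    have hsign : ∀ i : s, 0 < d i ↔ 0 < φ i x := fun i => by
      rw [← hx i]
      have := Finset.ext_iff.1 hsA i
      simpa using this.symm
    have hnn : ∀ i : s, 0 ≤ d i * φ i x := fun i => by
      by_cases h : 0 < d i
      · exact (mul_pos h ((hsign i).1 h)).le
      · exact mul_nonneg_of_nonpos_of_nonpos (not_lt.1 h) (not_lt.1 ((hsign i).not.1 h))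
    have hsum := Finset.sum_nonneg fun i (_ : i ∈ Finset.univ) => hnn i
    rw [hd x] at hsum
    obtain ⟨i, hi⟩ := hpos (le_antisymm hγ hsum)
    have : 0 < ∑ i, d i * φ i x :=
      Finset.sum_pos' (fun i _ => hnn i) ⟨i, Finset.mem_univ _, mul_pos hi ((hsign i).1 hi)⟩
    rw [hd x] at this
    exact absurd hγ (not_le.2 this)
  have hneg : ∀ x, ∑ i, (-c) i * φ i x = -∑ i, c i * φ i 0 := fun x => by
    rw [← hconst x, ← Finset.sum_neg_distrib]
    exact Finset.sum_congr rfl fun i _ => by simp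
  rcases lt_trichotomy (∑ i, c i * φ i 0) 0 with h | h | h
  · exact key c _ hconst h.le fun h' => absurd h' h.ne
  · rcases hi₀.lt_or_gt with h0 | h0
    · exact key (-c) _ hneg (by rw [h, neg_zero]) fun _ => ⟨i₀, by simpa using h0⟩
    · exact key c _ hconst h.le fun _ => ⟨i₀, h0⟩
  · exact key (-c) _ hneg (by simpa using h.le) fun h' => absurd h' (by simpa using h.ne')

/-- A family has at most as many members as sets it shatters (Pajor), and these have size at most
the dimension. -/
theorem card_signPatterns_le [Fintype α] {φ : α → E →ᵃ[ℝ] ℝ} {𝒜 : Finset (Finset α)}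
    (h𝒜 : ∀ A ∈ 𝒜, ∃ x, ∀ i, i ∈ A ↔ 0 < φ i x) (hα : 1 ≤ Fintype.card α) :
    𝒜.card ≤ (Module.finrank ℝ E + 1) * Fintype.card α ^ Module.finrank ℝ E := by
  have hvc : 𝒜.vcDim ≤ Module.finrank ℝ E :=
    Finset.sup_le fun s hs => card_le_finrank_of_shatters h𝒜 (Finset.mem_shatterer.1 hs)
  calc 𝒜.card ≤ ∑ j ∈ Finset.Iic 𝒜.vcDim, (Fintype.card α).choose j :=
        𝒜.card_le_card_shatterer.trans Finset.card_shatterer_le_sum_vcDim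
    _ ≤ ∑ j ∈ Finset.Iic (Module.finrank ℝ E), (Fintype.card α).choose j :=
        Finset.sum_le_sum_of_subset (Finset.Iic_subset_Iic.2 hvc)
    _ ≤ ∑ _j ∈ Finset.Iic (Module.finrank ℝ E), Fintype.card α ^ Module.finrank ℝ E :=
        Finset.sum_le_sum fun j hj => (Nat.choose_le_pow _ _).trans
          (Nat.pow_le_pow_right hα (Finset.mem_Iic.1 hj))
    _ = _ := by simp

end SignPatterns

/-- The number of linear regions of a shallow model is `O(sⁿ)`. -/
theorem deepSetComplexity_singleton_le {n s : ℕ} (hn : 1 ≤ n) (hs : 1 ≤ s) (k : ℕ) :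
    deepSetComplexity n [s] k ≤ ((n + 1) * (s * n) ^ n : ℕ) := by
  refine iSup₂_le fun f hf => (complexity_le_card_linearPieces f).trans ?_
  have hcont := continuous_of_mem_deepSetModels hf
  obtain ⟨_, ⟨g, -, _, ⟨h, -, rfl⟩, rfl⟩, hfF⟩ := hf
  let G : Euc n →ᵃ[ℝ] Feat n s := g.comp (toFeat n).toAffineMap
  -- Only patterns that occur are counted; all subsets would give a bound exponential in `s`.
  let 𝒜 : Finset (Finset (Fin s × Fin n)) :=
    (Set.toFinite (Set.range fun x : Euc n => activePattern (G x))).toFinset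
  refine (card_linearPieces_le (isClosed_unitCube n) (convex_unitCube n) hcont (ι := 𝒜)
    (fun A => G ⁻¹' {Y | activePattern Y = A})
    (fun A => (convex_setOf_activePattern_eq _).affine_preimage G) (fun x _ => ?_)
    fun A => ?_).trans ?_
  · exact Set.mem_iUnion.2 ⟨⟨activePattern (G x), by simp [𝒜]⟩, rfl⟩
  · refine ⟨h.comp ((maskMap A.1).toAffineMap.comp G), fun x hx => ?_⟩
    have h1 : activePattern (G x) = A.1 := hx
    have h2 : reluMap (G x) = maskMap A.1 (G x) := by rw [← h1, reluMap_eq_maskMap]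
    exact (hfF x).trans (congrArg h h2)
  · rw [ENat.card_eq_coe_fintype_card, Nat.cast_le, Fintype.card_coe]
    let π : Fin s × Fin n → Feat n s →ₗ[ℝ] ℝ := fun p =>
      (LinearMap.proj (φ := fun _ : Fin n => ℝ) p.2).comp
        (LinearMap.proj (φ := fun _ : Fin s => Fin n → ℝ) p.1)
    have := card_signPatterns_le (φ := fun p => (π p).toAffineMap.comp G) (𝒜 := 𝒜) ?_ ?_
    · simpa using this
    · intro A hA
      obtain ⟨x, rfl⟩ : ∃ x, activePattern (G x) = A := by simpa [𝒜] using hA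
      exact ⟨x, fun p => mem_activePattern⟩
    · simpa [Nat.one_le_iff_ne_zero, Nat.pos_iff_ne_zero] using Nat.mul_pos hs hn

/-! ### Separable deep set models with many slopes -/

/-- The affine map is absorbed into the first affine map of the model. Recombining rectified
channels into a zigzag therefore costs no extra layer. -/
theorem comp_mem_deepSetFrom {n k a a' : ℕ} {m : List ℕ} {F : Feat n a → (Fin k → ℝ)}
    (hF : F ∈ deepSetFrom n k a m) (A : Feat n a' →ᵃ[ℝ] Feat n a) (hA : PermEquivariant A) :
    (fun X => F (A X)) ∈ deepSetFrom n k a' m := by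
  cases m with
  | nil =>
    obtain ⟨f, hf, rfl⟩ := hF
    exact ⟨f.comp A, fun σ X => by simp [hA σ X, hf σ (A X)], rfl⟩
  | cons b m =>
    obtain ⟨f, hf, h, hh, rfl⟩ := hF
    exact ⟨f.comp A, fun σ X => by simp [hA σ X, hf σ (A X)], h, hh, rfl⟩

/-- The equivariant linear combination of channels with coefficients `c`. -/
noncomputable def channelSum (n : ℕ) {a : ℕ} (c : Fin a → ℝ) : Feat n a →ₗ[ℝ] Feat n 1 where
  toFun X _ j := ∑ i, c i * X i j
  map_add' X Y := by ext i j; simp [mul_add, Finset.sum_add_distrib]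
  map_smul' r X := by
    ext i j
    simp only [Pi.smul_apply, smul_eq_mul, RingHom.id_apply, Finset.mul_sum]
    exact Finset.sum_congr rfl fun _ _ => by ring

theorem permEquivariant_channelSum {n a : ℕ} (c : Fin a → ℝ) :
    PermEquivariant (channelSum n c).toAffineMap := fun _ _ => rfl

/-- The equivariant affine map whose `i`-th channel is the input shifted by `u i`. -/
noncomputable def channelShift (n : ℕ) {a : ℕ} (u : Fin a → ℝ) : Feat n 1 →ᵃ[ℝ] Feat n a where
  toFun X i j := X 0 j - u i
  linear :=
    { toFun := fun X _ j => X 0 j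
      map_add' := fun _ _ => rfl
      map_smul' := fun _ _ => rfl }
  map_vadd' X Y := by
    ext i j
    simp only [vadd_eq_add, Pi.add_apply, LinearMap.coe_mk, AddHom.coe_mk]
    ring

theorem permEquivariant_channelShift {n a : ℕ} (u : Fin a → ℝ) :
    PermEquivariant (channelShift n u) := fun _ _ => rfl

/-- The breakpoints of a zigzag function with values in `[0, T]` whose slopes have absolute
values `1, b, b², …`. -/
noncomputable def zigzagBreak (T b : ℝ) (q : ℕ) : ℝ := ∑ i ∈ Finset.range q, T / b ^ i

/-- The change of slope of the zigzag function at its `j`-th breakpoint. -/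
noncomputable def zigzagCoeff (b : ℝ) : ℕ → ℝ
  | 0 => 1
  | j + 1 => (-1) ^ (j + 1) * (b ^ (j + 1) + b ^ j)

/-- The zigzag function with `p` pieces. -/
noncomputable def zigzag (T b : ℝ) (p : ℕ) (t : ℝ) : ℝ :=
  ∑ j ∈ Finset.range p, zigzagCoeff b j * max 0 (t - zigzagBreak T b j)

theorem zigzagBreak_succ (T b : ℝ) (q : ℕ) :
    zigzagBreak T b (q + 1) = zigzagBreak T b q + T / b ^ q := Finset.sum_range_succ _ _

theorem monotone_zigzagBreak {T b : ℝ} (hT : 0 < T) (hb : 0 < b) : Monotone (zigzagBreak T b) :=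
  monotone_nat_of_le_succ fun q => by
    rw [zigzagBreak_succ]
    have : 0 < T / b ^ q := by positivity
    linarith

/-- With the first q + 1 rectifiers active, the slopes telescope to (-1)^q b^q. The constant is the
value at the q-th breakpoint: 0 for even q, T for odd q. -/
theorem sum_zigzagCoeff {b : ℝ} (hb : 0 < b) (T t : ℝ) (q : ℕ) :
    ∑ j ∈ Finset.range (q + 1), zigzagCoeff b j * (t - zigzagBreak T b j) =
      T * ((1 - (-1) ^ q) / 2) + (-1) ^ q * b ^ q * (t - zigzagBreak T b q) := by
  induction q with
  | zero => simp [zigzagCoeff]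
  | succ q ih =>
    have h : b ^ q * (T / b ^ q) = T := mul_div_cancel₀ T (pow_pos hb q).ne'
    rw [Finset.sum_range_succ, ih, zigzagBreak_succ, zigzagCoeff, pow_succ (-1 : ℝ) q]
    linear_combination (-1) ^ q * h

theorem zigzag_eq {T b : ℝ} (hT : 0 < T) (hb : 0 < b) {p q : ℕ} (hq : q < p) {t : ℝ}
    (h1 : zigzagBreak T b q ≤ t) (h2 : t ≤ zigzagBreak T b (q + 1)) :
    zigzag T b p t =
      T * ((1 - (-1) ^ q) / 2) + (-1) ^ q * b ^ q * (t - zigzagBreak T b q) := by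
  have hmono := monotone_zigzagBreak hT hb
  rw [← sum_zigzagCoeff hb, zigzag,
    ← Finset.sum_subset (Finset.range_subset_range.2 (Nat.succ_le_of_lt hq))]
  · refine Finset.sum_congr rfl fun j hj => ?_
    have : zigzagBreak T b j ≤ zigzagBreak T b q :=
      hmono (Nat.lt_succ_iff.1 (Finset.mem_range.1 hj))
    rw [max_eq_right (by linarith)]
  · intro j _ hj
    have : zigzagBreak T b (q + 1) ≤ zigzagBreak T b j :=
      hmono (not_lt.1 fun h => hj (Finset.mem_range.2 h))
    rw [max_eq_left (by linarith), mul_zero]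

/-- Precomposing with the zigzag function multiplies a slope by a power of `b`. -/
theorem exists_slope_comp_zigzag {T b : ℝ} (hT : 0 < T) (hb : 0 < b) {p q : ℕ} (hq : q < p)
    {h : ℝ → ℝ} {u v s c : ℝ} (hu : 0 ≤ u) (huv : u < v) (hv : v ≤ T)
    (hh : ∀ t ∈ Set.Ioo u v, h t = s * t + c) :
    ∃ u' v', 0 ≤ u' ∧ u' < v' ∧ v' ≤ zigzagBreak T b p ∧ ∃ s' c', |s'| = |s| * b ^ q ∧
      ∀ t ∈ Set.Ioo u' v', h (zigzag T b p t) = s' * t + c' := by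
  have hbq : 0 < b ^ q := pow_pos hb q
  have h0 : 0 ≤ zigzagBreak T b q := Finset.sum_nonneg fun i _ => by positivity
  have hp : zigzagBreak T b q + T / b ^ q ≤ zigzagBreak T b p := by
    rw [← zigzagBreak_succ]
    exact monotone_zigzagBreak hT hb hq
  set z := zigzagBreak T b q with hz
  -- On the q-th piece y = b^q (t - z) runs over [0, T]; the zigzag equals y on rising pieces and T
  -- - y on falling ones, where the window (u, v) is reflected.
  have hmain : ∀ {y₁ y₂ : ℝ}, 0 ≤ y₁ → y₁ < y₂ → y₂ ≤ T →
      (∀ y ∈ Set.Ioo y₁ y₂, T * ((1 - (-1) ^ q) / 2) + (-1) ^ q * y ∈ Set.Ioo u v) →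
      ∃ u' v', 0 ≤ u' ∧ u' < v' ∧ v' ≤ zigzagBreak T b p ∧ ∃ s' c', |s'| = |s| * b ^ q ∧
        ∀ t ∈ Set.Ioo u' v', h (zigzag T b p t) = s' * t + c' := by
    intro y₁ y₂ h1 h12 h2 hy
    refine ⟨z + y₁ / b ^ q, z + y₂ / b ^ q, by positivity, by gcongr, le_trans (by gcongr) hp,
      s * ((-1) ^ q * b ^ q),
      s * (T * ((1 - (-1) ^ q) / 2) - (-1) ^ q * b ^ q * z) + c, ?_, ?_⟩
    · rw [abs_mul, abs_mul, abs_pow, abs_neg, abs_one, one_pow, one_mul, abs_of_pos hbq]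
    · rintro t ⟨ht1, ht2⟩
      have hy₁ : 0 ≤ y₁ / b ^ q := by positivity
      have hy₂ : y₂ / b ^ q ≤ T / b ^ q := by gcongr
      have hm1 : y₁ < b ^ q * (t - z) := by
        rw [← div_lt_iff₀' hbq]; linarith
      have hm2 : b ^ q * (t - z) < y₂ := by
        rw [← lt_div_iff₀' hbq]; linarith
      rw [zigzag_eq hT hb hq (by linarith) (by rw [zigzagBreak_succ]; linarith), ← hz, mul_assoc,
        hh _ (hy _ ⟨hm1, hm2⟩)]
      ring
  rcases neg_one_pow_eq_or ℝ q with h1 | h1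
  · refine hmain hu huv hv fun y hy => ?_
    rw [h1]
    simpa using hy
  · refine hmain (y₁ := T - v) (y₂ := T - u) (by linarith) (by linarith) (by linarith)
      fun y hy => ?_
    rw [h1]
    constructor <;> linarith [hy.1, hy.2]

/-- Deep set models contain functions `∑ j, h (x j)` for which the absolute slopes of `h` take
the values `1, b, …, b ^ (m₁ ⋯ m_L - 1)`. -/
theorem exists_separable_mem_deepSetFrom (n k : ℕ) (m : List ℕ) : ∀ b : ℝ, 0 < b →
    ∃ T : ℝ, 0 < T ∧ ∃ h : ℝ → ℝ,
      (fun (X : Feat n 1) (_ : Fin k) => ∑ j, h (X 0 j)) ∈ deepSetFrom n k 1 m ∧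
      ∀ e < m.prod, ∃ u v, 0 ≤ u ∧ u < v ∧ v ≤ T ∧ ∃ s c, |s| = b ^ e ∧
        ∀ t ∈ Set.Ioo u v, h t = s * t + c := by
  induction m with
  | nil =>
    refine fun b hb => ⟨1, one_pos, id, ⟨LinearMap.toAffineMap
      { toFun := fun X _ => ∑ j, X 0 j
        map_add' := fun X Y => by ext; simp [Finset.sum_add_distrib]
        map_smul' := fun r X => by ext; simp [Finset.mul_sum] }, fun σ X => ?_, rfl⟩, ?_⟩
    · ext i
      exact Equiv.sum_comp σ⁻¹ fun j => X 0 j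
    · intro e he
      obtain rfl : e = 0 := by simpa using he
      exact ⟨0, 1, le_rfl, one_pos, le_rfl, 1, 0, by simp, fun t _ => by simp⟩
  | cons p m ih =>
    intro b hb
    rcases Nat.eq_zero_or_pos p with rfl | hp
    -- A zero width makes the product 0, so only membership is at stake.
    · obtain ⟨T, hT, h, hh, -⟩ := ih 1 one_pos
      refine ⟨1, one_pos, fun _ => h 0, ⟨0, fun _ _ => rfl, _,
        comp_mem_deepSetFrom hh 0 (fun _ _ => rfl), rfl⟩, by simp⟩
    -- With base b^p for the later layers, e = p (e / p) + e % p splits each exponent between the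
    -- later layers and this one.
    · obtain ⟨T, hT, h, hh, hs⟩ := ih (b ^ p) (pow_pos hb p)
      refine ⟨zigzagBreak T b p, ?_, fun t => h (zigzag T b p t), ?_, fun e he => ?_⟩
      · exact Finset.sum_pos (fun i _ => by positivity) ⟨0, Finset.mem_range.2 hp⟩
      · refine ⟨channelShift n fun i : Fin p => zigzagBreak T b i,
          permEquivariant_channelShift _, _,
          comp_mem_deepSetFrom hh (channelSum n fun i : Fin p => zigzagCoeff b i).toAffineMap
            (permEquivariant_channelSum _), ?_⟩
        funext X _
        refine Finset.sum_congr rfl fun j _ => congrArg h ?_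
        exact (Fin.sum_univ_eq_sum_range
          (fun i => zigzagCoeff b i * max 0 (X 0 j - zigzagBreak T b i)) p).symm
      · rw [List.prod_cons] at he
        obtain ⟨u, v, hu, huv, hv, s, c, hsb, hsc⟩ := hs (e / p) (Nat.div_lt_of_lt_mul he)
        obtain ⟨u', v', hu', huv', hv', s', c', hs', hsc'⟩ :=
          exists_slope_comp_zigzag hT hb (Nat.mod_lt e hp) hu huv hv hsc
        refine ⟨u', v', hu', huv', hv', s', c', ?_, hsc'⟩
        rw [hs', hsb, ← pow_mul, ← pow_add, Nat.div_add_mod]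

/-! ### Inequivalent linear regions -/

/-- Uniqueness of base B digits: reduce modulo B, then cancel B. -/
theorem eq_of_sum_range_mul_pow_eq {B : ℕ} (N : ℕ) : ∀ {f g : ℕ → ℕ}, (∀ i, f i < B) →
    (∀ i, g i < B) →
    ∑ i ∈ Finset.range N, f i * B ^ i = ∑ i ∈ Finset.range N, g i * B ^ i →
    ∀ i < N, f i = g i := by
  induction N with
  | zero => intro f g _ _ _ i hi; omega
  | succ N ih =>
    intro f g hf hg h
    have hstep : ∀ f : ℕ → ℕ, ∑ i ∈ Finset.range (N + 1), f i * B ^ i =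
        f 0 + B * ∑ i ∈ Finset.range N, f (i + 1) * B ^ i := fun f => by
      rw [Finset.sum_range_succ', Finset.mul_sum, add_comm]
      congr 1
      · simp
      · exact Finset.sum_congr rfl fun _ _ => by ring
    rw [hstep, hstep] at h
    have h0 : f 0 = g 0 := by
      have := congrArg (· % B) h
      simpa [Nat.add_mul_mod_self_left, Nat.mod_eq_of_lt (hf 0), Nat.mod_eq_of_lt (hg 0)] using this
    have hB : 0 < B := (Nat.zero_le _).trans_lt (hf 0)
    have h1 := Nat.eq_of_mul_eq_mul_left hB (Nat.add_left_cancel (h0 ▸ h))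
    intro i hi
    cases i with
    | zero => exact h0
    | succ i => exact ih (fun i => hf _) (fun i => hg _) h1 i (by omega)

/-- A multiset with fewer than `B` elements is determined by the sum of the powers of `B` with
exponents in it. -/
theorem Sym.eq_of_sum_map_pow_eq {n N B : ℕ} (hB : n < B) {S S' : Sym (Fin N) n}
    (h : (S.1.map fun i : Fin N => B ^ (i : ℕ)).sum = (S'.1.map fun i : Fin N => B ^ (i : ℕ)).sum) : S = S' := by
  classical
  let cnt : Sym (Fin N) n → ℕ → ℕ := fun S i => if hi : i < N then S.1.count ⟨i, hi⟩ else 0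
  have hlt : ∀ S i, cnt S i < B := fun S i => by
    simp only [cnt]
    split_ifs with hi
    · exact ((Multiset.count_le_card _ _).trans S.2.le).trans_lt hB
    · omega
  have hsum : ∀ S : Sym (Fin N) n, (S.1.map fun i : Fin N => B ^ (i : ℕ)).sum =
      ∑ i ∈ Finset.range N, cnt S i * B ^ i := fun S => by
    rw [Finset.sum_multiset_map_count, ← Fin.sum_univ_eq_sum_range (fun i => cnt S i * B ^ i) N]
    simp only [cnt, Fin.is_lt, dite_true, smul_eq_mul, Fin.eta]
    refine Finset.sum_subset (Finset.subset_univ _) fun i _ hi => ?_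
    rw [Multiset.mem_toFinset] at hi
    rw [Multiset.count_eq_zero_of_notMem hi, zero_mul]
  rw [hsum, hsum] at h
  refine Subtype.ext (Multiset.ext.2 fun i => ?_)
  have := eq_of_sum_range_mul_pow_eq N (hlt S) (hlt S') h i i.2
  simpa [cnt] using this

theorem Multiset.exists_map_univ_eq {α : Type*} {n : ℕ} (S : Multiset α)
    (hS : Multiset.card S = n) : ∃ e : Fin n → α, (Finset.univ : Finset (Fin n)).val.map e = S := by
  subst hS
  induction S using Quotient.inductionOn with
  | _ l => exact ⟨l.get, (Fin.univ_val_map l.get).trans (congrArg _ (List.ofFn_get l))⟩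

/-- The affine map with gradient `w` in every component. -/
noncomputable def gradientMap {n : ℕ} (k : ℕ) (w : Euc n) (c : ℝ) : Euc n →ᵃ[ℝ] (Fin k → ℝ) :=
  AffineMap.pi fun _ => (innerSL ℝ w).toLinearMap.toAffineMap + AffineMap.const ℝ (Euc n) c

theorem gradientMap_apply {n k : ℕ} (w : Euc n) (c : ℝ) (x : Euc n) (i : Fin k) :
    gradientMap k w c x i = inner ℝ w x + c := rfl

/-- Agreement on an open set is agreement everywhere, so the orthogonal part of `φ` carries one
gradient to the other. One output component is read off, whence `1 ≤ k`. -/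
theorem norm_eq_of_gradientMap_eq {n k : ℕ} (hk : 1 ≤ k) {w w' : Euc n} {c c' : ℝ}
    {φ : Euc n ≃ᵃⁱ[ℝ] Euc n} {U : Set (Euc n)} (hU : IsOpen U) (hne : U.Nonempty)
    (h : ∀ x ∈ U, gradientMap k w c x = gradientMap k w' c' (φ x)) : ‖w‖ = ‖w'‖ := by
  have heq : gradientMap k w c = (gradientMap k w' c').comp φ.toAffineEquiv.toAffineMap :=
    AffineMap.eq_of_eqOn_isOpen hU hne h
  have hlin : ∀ v, inner ℝ w v = inner ℝ w' (φ.linearIsometryEquiv v) := fun v => by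
    have h1 := congrFun (DFunLike.congr_fun heq v) ⟨0, hk⟩
    have h0 := congrFun (DFunLike.congr_fun heq 0) ⟨0, hk⟩
    change inner ℝ w v + c = inner ℝ w' (φ v) + c' at h1
    change inner ℝ w 0 + c = inner ℝ w' (φ 0) + c' at h0
    have h2 : φ v = φ.linearIsometryEquiv v + φ 0 := by
      simpa using φ.map_vadd 0 v
    rw [h2, inner_add_right] at h1
    rw [inner_zero_right] at h0
    linarith
  have hw : w = φ.linearIsometryEquiv.symm w' := ext_inner_right ℝ fun v => by
    rw [hlin, ← φ.linearIsometryEquiv.inner_map_map (φ.linearIsometryEquiv.symm w') v, LinearIsometryEquiv.apply_symm_apply]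
  rw [hw, LinearIsometryEquiv.norm_map]

/-- Deep set models have at least as many inequivalent linear regions as there are multisets of
size `n` with `m₁ ⋯ m_L` kinds of elements. -/
theorem card_sym_le_deepSetComplexity (n : ℕ) {k : ℕ} (hk : 1 ≤ k) (m : List ℕ) :
    (Fintype.card (Sym (Fin m.prod) n) : ℕ∞) ≤ deepSetComplexity n m k := by
  obtain ⟨T, hT, h, hF, hs⟩ := exists_separable_mem_deepSetFrom n k m (n + 1) (by positivity)
  -- Rescaling maps the unit interval onto [0, T], where the slopes occur.
  have hF' := comp_mem_deepSetFrom hF (T • LinearMap.id).toAffineMap (fun _ _ => rfl)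
  let f : unitCube n → (Fin k → ℝ) := fun x _ => ∑ j, h (T * (x : Euc n) j)
  have hfm : f ∈ deepSetModels n m k := ⟨_, hF', fun x => rfl⟩
  have hfc := continuous_of_mem_deepSetModels hfm
  choose u v hu huv hv s c hsb hsc using fun e : Fin m.prod => hs e e.2
  choose e he using fun S : Sym (Fin m.prod) n => Multiset.exists_map_univ_eq S.1 S.2
  let w : Sym (Fin m.prod) n → Euc n := fun S => WithLp.toLp 2 fun j => T * s (e S j)
  let l : Sym (Fin m.prod) n → (Euc n →ᵃ[ℝ] (Fin k → ℝ)) := fun S =>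
    gradientMap k (w S) (∑ j, c (e S j))
  let U : Sym (Fin m.prod) n → Set (Euc n) := fun S =>
    ⋂ j : Fin n, (fun x : Euc n => x j) ⁻¹' Set.Ioo (u (e S j) / T) (v (e S j) / T)
  have hUmem : ∀ S x, x ∈ U S → ∀ j, u (e S j) < T * x j ∧ T * x j < v (e S j) := by
    intro S x hx j
    have := Set.mem_iInter.1 hx j
    exact ⟨(div_lt_iff₀' hT).1 this.1, (lt_div_iff₀' hT).1 this.2⟩
  have hUo : ∀ S, IsOpen (U S) := fun S =>
    isOpen_iInter_of_finite fun j => isOpen_Ioo.preimage (by fun_prop)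
  have hUc : ∀ S, IsConnected (U S) := fun S => by
    refine Convex.isConnected (convex_iInter fun j => ?_) ?_
    · exact fun x hx y hy a b ha hb hab => convex_Ioo _ _ hx hy ha hb hab
    · refine ⟨WithLp.toLp 2 fun j => (u (e S j) + v (e S j)) / 2 / T, Set.mem_iInter.2 fun j => ?_⟩
      have := huv (e S j)
      constructor
      · change u (e S j) / T < (u (e S j) + v (e S j)) / 2 / T
        gcongr
        linarith
      · change (u (e S j) + v (e S j)) / 2 / T < v (e S j) / T
        gcongr
        linarith
  have hUl : ∀ S, U S ⊆ agreeSet f (l S) := by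
    intro S x hx
    refine ⟨fun j => ⟨?_, ?_⟩, ?_⟩
    · exact (pos_of_mul_pos_right ((hu _).trans_lt (hUmem S x hx j).1) hT.le).le
    · have := (hUmem S x hx j).2.trans_le (hv _)
      nlinarith
    · funext i
      rw [gradientMap_apply, PiLp.inner_apply, ← Finset.sum_add_distrib]
      refine Finset.sum_congr rfl fun j _ => ?_
      rw [hsc _ _ (hUmem S x hx j)]
      simp [w]
      ring
  choose D hD hUD hDl using fun S =>
    exists_isLinearRegion_of_subset_agreeSet (isClosed_unitCube n) hfc (hUo S) (hUc S) (hUl S)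
  have hnorm : ∀ S, ‖w S‖ ^ 2 =
      T ^ 2 * ((S.1.map fun i : Fin m.prod => ((n + 1) ^ 2) ^ (i : ℕ)).sum : ℕ) := fun S => by
    rw [EuclideanSpace.norm_sq_eq, ← he S, Multiset.map_map]
    change _ = T ^ 2 * ((∑ j, ((n + 1) ^ 2) ^ (e S j : ℕ) : ℕ) : ℝ)
    push_cast
    rw [Finset.mul_sum]
    refine Finset.sum_congr rfl fun j _ => ?_
    simp only [w, Real.norm_eq_abs, abs_mul, mul_pow, sq_abs, hsb]
    rw [← pow_mul, ← pow_mul, mul_comm 2]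
  have hinj : Function.Injective fun S =>
      (Quotient.mk (pieceSetoid f) ⟨D S, hD S⟩ : Quotient (pieceSetoid f)) := by
    intro S S' hSS
    obtain ⟨φ, hφ, hφf⟩ : PieceEquiv f (D S) (D S') := Quotient.exact hSS
    have hww : ‖w S‖ = ‖w S'‖ := by
      refine norm_eq_of_gradientMap_eq hk (c := ∑ j, c (e S j))
        (c' := ∑ j, c (e S' j)) (φ := φ) (hUo S) (hUc S).nonempty fun x hx => ?_
      obtain ⟨hxK, hxl⟩ := hUl S hx
      have hy : φ x ∈ D S' := hφ ▸ Set.mem_image_of_mem φ (hUD S hx)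
      obtain ⟨hyK, hyl⟩ := hDl S' hy
      exact hxl.symm.trans ((hφf ⟨x, hxK⟩ ⟨φ x, hyK⟩ (hUD S hx) rfl).trans hyl)
    have h2 := congrArg (· ^ 2) hww
    simp only [hnorm] at h2
    have h3 := mul_left_cancel₀ (pow_pos hT 2).ne' h2
    -- Multiplicities are at most n < (n + 1)^2, hence valid digits.
    exact Sym.eq_of_sum_map_pow_eq (B := (n + 1) ^ 2) (by nlinarith) (Nat.cast_injective h3)
  calc (Fintype.card (Sym (Fin m.prod) n) : ℕ∞) = ENat.card (Sym (Fin m.prod) n) :=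
        ENat.card_eq_coe_fintype_card.symm
    _ ≤ complexity f := ENat.card_le_card_of_injective hinj
    _ ≤ deepSetComplexity n m k := le_iSup₂ (f := fun f _ => complexity f) f hfm

/-! ### Bounds -/

theorem pow_div_factorial_le {n : ℕ} (hn : 1 ≤ n) :
    (n : ℝ) ^ n / (n.factorial : ℝ) ≤ Real.exp 1 ^ n / √n := by
  have hn0 : (0 : ℝ) < n := by exact_mod_cast hn
  have h := Stirling.le_factorial_stirling n
  have h1 : √(n : ℝ) ≤ √(2 * Real.pi * n) :=
    Real.sqrt_le_sqrt (by nlinarith [Real.pi_gt_three])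
  have h2 : √(n : ℝ) * ((n : ℝ) / Real.exp 1) ^ n ≤ n.factorial :=
    (mul_le_mul_of_nonneg_right h1 (by positivity)).trans h
  rw [div_pow, mul_div_assoc', div_le_iff₀ (by positivity)] at h2
  rw [div_le_div_iff₀ (by positivity) (by positivity)]
  linarith

/-- The Stirling sequence n! / (√(2n) (n/e)^n) decreases from e / √2, so n! ≤ e √n (n/e)^n. -/
theorem exp_mul_le_pow_div_factorial {n : ℕ} (hn : 1 ≤ n) :
    Real.exp (-1) * (Real.exp 1 ^ n / √n) ≤ (n : ℝ) ^ n / (n.factorial : ℝ) := by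
  obtain ⟨r, rfl⟩ : ∃ r, n = r + 1 := ⟨n - 1, by omega⟩
  set n := r + 1
  have hn0 : (0 : ℝ) < n := by exact_mod_cast hn
  have h : Stirling.stirlingSeq n ≤ Stirling.stirlingSeq 1 :=
    Stirling.stirlingSeq'_antitone (Nat.zero_le r)
  rw [Stirling.stirlingSeq_one, Stirling.stirlingSeq, div_le_iff₀ (by positivity),
    Real.sqrt_mul (by norm_num)] at h
  have h2 : (0 : ℝ) < √2 := by positivity
  have h3 : (n.factorial : ℝ) ≤ Real.exp 1 * (√n * (n : ℝ) ^ n) / Real.exp 1 ^ n := by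
    refine h.trans_eq ?_
    rw [div_pow]
    field_simp
  rw [le_div_iff₀ (by positivity)] at h3
  rw [Real.exp_neg, inv_mul_eq_div, div_div, div_le_div_iff₀ (by positivity) (by positivity)]
  linarith

theorem pow_le_factorial_mul_deepSetComplexity {n k : ℕ} (hn : 1 ≤ n) (hk : 1 ≤ k) (m : List ℕ) :
    (m.prod : ℝ) ^ n ≤ (n.factorial : ℝ) * ((deepSetComplexity n m k).toNat : ℝ) := by
  have h := ENat.toNat_le_toNat (card_sym_le_deepSetComplexity n hk m)
    (deepSetComplexity_ne_top n m k)
  rw [ENat.toNat_natCast, Sym.card_sym_eq_choose, Fintype.card_fin] at h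
  have h1 := Nat.pow_le_choose (α := ℝ) n (m.prod + n - 1)
  rw [show m.prod + n - 1 + 1 - n = m.prod by omega, div_le_iff₀' (by positivity)] at h1
  exact h1.trans (mul_le_mul_of_nonneg_left (by exact_mod_cast h) (by positivity))

theorem toNat_deepSetComplexity_singleton_le {n s : ℕ} (hn : 1 ≤ n) (hs : 1 ≤ s) (k : ℕ) :
    ((deepSetComplexity n [s] k).toNat : ℝ) ≤ (n + 1) * (n : ℝ) ^ n * (s : ℝ) ^ n := by
  have h := ENat.toNat_le_toNat (deepSetComplexity_singleton_le hn hs k)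
    (ENat.natCast_ne_top _)
  rw [ENat.toNat_natCast] at h
  have h' : ((deepSetComplexity n [s] k).toNat : ℝ) ≤ ((n + 1) * (s * n) ^ n : ℕ) := by
    exact_mod_cast h
  refine h'.trans_eq ?_
  push_cast
  ring

/-- Each entry times w^(L-1) is at most the product, since the other L - 1 factors are at least w;
summing over entries bounds product over sum below by w^(L-1) / L. -/
theorem List.pow_length_mul_sum_le {w : ℕ} {m : List ℕ} (hm : ∀ a ∈ m, w ≤ a) :
    w ^ (m.length - 1) * m.sum ≤ m.length * m.prod := by
  have key : ∀ a ∈ m, w ^ (m.length - 1) * a ≤ m.prod := by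
    intro a ha
    have hp := List.prod_erase ha
    have hl := List.length_erase_of_mem ha
    rw [← hp, ← hl, mul_comm]
    refine Nat.mul_le_mul_left a ?_
    have : ∀ l : List ℕ, (∀ x ∈ l, w ≤ x) → w ^ l.length ≤ l.prod := fun l => by
      induction l with
      | nil => simp
      | cons x l ih =>
        intro h
        rw [List.length_cons, pow_succ', List.prod_cons]
        exact Nat.mul_le_mul (h x (by simp)) (ih fun y hy => h y (by simp [hy]))
    exact this _ fun x hx => hm x (List.mem_of_mem_erase hx)
  have h := List.sum_le_card_nsmul (m.map fun a => w ^ (m.length - 1) * a) m.prod (by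
    intro x hx
    obtain ⟨a, ha, rfl⟩ := List.mem_map.1 hx
    exact key a ha)
  rw [List.sum_map_mul_left] at h
  simpa using h

theorem List.one_le_sum {m : List ℕ} (hm : m ≠ []) (h : ∀ a ∈ m, 1 ≤ a) : 1 ≤ m.sum := by
  obtain ⟨a, ha⟩ := List.exists_mem_of_ne_nil m hm
  exact (h a ha).trans (List.le_sum_of_mem ha)

theorem mainTheorem4 :
    -- the maximum defining the measure of complexity exists and is finite
    (∀ n : ℕ, 1 ≤ n → ∀ (m : List ℕ) (k : ℕ), m ≠ [] → (∀ a ∈ m, 1 ≤ a) → 1 ≤ k →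
      deepSetComplexity n m k ≠ ⊤ ∧
        ∃ f ∈ deepSetModels n m k, complexity f = deepSetComplexity n m k) ∧
    -- the first lower bound
    (∀ n : ℕ, 1 ≤ n → ∃ C : ℝ, 0 < C ∧
      ∀ (m : List ℕ) (k : ℕ), m ≠ [] → (∀ a ∈ m, 1 ≤ a) → 1 ≤ k →
        C * ((m.prod : ℝ) ^ n * ((n : ℝ) ^ n / (n.factorial : ℝ))) ≤
          ((deepSetComplexity n m k).toNat : ℝ)) ∧
    -- the second lower bound
    (∀ n : ℕ, 1 ≤ n → ∃ C : ℝ, 0 < C ∧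
      ∀ (m : List ℕ) (k : ℕ), m ≠ [] → (∀ a ∈ m, 1 ≤ a) → 1 ≤ k →
        C * (((m.prod : ℝ) * Real.exp 1) ^ n / Real.sqrt n) ≤
          ((deepSetComplexity n m k).toNat : ℝ)) ∧
    -- the two bounds agree up to absolute constants
    (∃ c₁ c₂ : ℝ, 0 < c₁ ∧ 0 < c₂ ∧ ∀ n M : ℕ, 1 ≤ n →
      c₁ * (((M : ℝ) * Real.exp 1) ^ n / Real.sqrt n) ≤
          (M : ℝ) ^ n * ((n : ℝ) ^ n / (n.factorial : ℝ)) ∧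
        (M : ℝ) ^ n * ((n : ℝ) ^ n / (n.factorial : ℝ)) ≤
          c₂ * (((M : ℝ) * Real.exp 1) ^ n / Real.sqrt n)) ∧
    -- the shallow model with the same number of hidden units
    (∀ n : ℕ, 1 ≤ n → ∃ C₁ C₂ : ℝ, 0 < C₁ ∧ 0 < C₂ ∧
      ∀ (m : List ℕ) (k : ℕ), m ≠ [] → (∀ a ∈ m, 1 ≤ a) → 1 ≤ k →
        C₁ * (((m.sum : ℝ) * Real.exp 1) ^ n / Real.sqrt n) ≤
            ((deepSetComplexity n [m.sum] k).toNat : ℝ) ∧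
          ((deepSetComplexity n [m.sum] k).toNat : ℝ) ≤
            C₂ * (((m.sum : ℝ) * Real.exp 1) ^ n / Real.sqrt n)) ∧
    -- deep models are exponentially more complex than shallow ones
    (∀ n : ℕ, 1 ≤ n → ∃ C : ℝ, 0 < C ∧
      ∀ (m : List ℕ) (k : ℕ), m ≠ [] → (∀ a ∈ m, 1 ≤ a) → 1 ≤ k →
        C * ((m.prod : ℝ) / (m.sum : ℝ)) ^ n * ((deepSetComplexity n [m.sum] k).toNat : ℝ) ≤
            ((deepSetComplexity n m k).toNat : ℝ) ∧
          ∀ w : ℕ, 2 ≤ w → (∀ a ∈ m, w ≤ a) →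
            C * ((w : ℝ) ^ (m.length - 1) / (m.length : ℝ)) ^ n *
                ((deepSetComplexity n [m.sum] k).toNat : ℝ) ≤
              ((deepSetComplexity n m k).toNat : ℝ)) := by
  have hpos : ∀ n : ℕ, 1 ≤ n → 0 < Real.exp 1 ^ n / √(n : ℝ) := fun n hn => by
    have : (0 : ℝ) < n := by exact_mod_cast hn
    positivity
  have hsecond : ∀ n : ℕ, 1 ≤ n → ∀ (m : List ℕ) (k : ℕ), 1 ≤ k →
      (1 / (n.factorial * (Real.exp 1 ^ n / √(n : ℝ)))) *
        (((m.prod : ℝ) * Real.exp 1) ^ n / √(n : ℝ)) ≤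
          ((deepSetComplexity n m k).toNat : ℝ) := by
    intro n hn m k hk
    have h := pow_le_factorial_mul_deepSetComplexity hn hk m
    have hb := hpos n hn
    rw [mul_pow, mul_div_assoc, one_div_mul_eq_div, div_le_iff₀ (by positivity)]
    nlinarith
  have hratio : ∀ n : ℕ, 1 ≤ n → ∀ (m : List ℕ) (k : ℕ), m ≠ [] → (∀ a ∈ m, 1 ≤ a) → 1 ≤ k →
      -- The constant pairs the factor (n + 1) n^n of the shallow upper bound with the n! of the
      -- deep lower bound.
      (1 / ((n + 1) * (n : ℝ) ^ n * n.factorial)) * ((m.prod : ℝ) / (m.sum : ℝ)) ^ n *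
        ((deepSetComplexity n [m.sum] k).toNat : ℝ) ≤
          ((deepSetComplexity n m k).toNat : ℝ) := by
    intro n hn m k hm hm1 hk
    have h := pow_le_factorial_mul_deepSetComplexity hn hk m
    have hs := List.one_le_sum hm hm1
    have h' := toNat_deepSetComplexity_singleton_le hn hs k
    have hs0 : (0 : ℝ) < m.sum := by exact_mod_cast hs
    have hn0 : (0 : ℝ) < n := by exact_mod_cast hn
    calc _ ≤ (1 / ((n + 1) * (n : ℝ) ^ n * n.factorial)) * ((m.prod : ℝ) / (m.sum : ℝ)) ^ n *
          ((n + 1) * (n : ℝ) ^ n * (m.sum : ℝ) ^ n) := by gcongr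
      _ = (m.prod : ℝ) ^ n / n.factorial := by rw [div_pow]; field_simp
      _ ≤ _ := by rwa [div_le_iff₀' (by positivity)]
  refine ⟨fun n _ m k _ _ _ => ⟨deepSetComplexity_ne_top n m k,
    exists_complexity_eq_deepSetComplexity n m k⟩, fun n hn => ?_, fun n hn => ?_, ?_,
    fun n hn => ?_, fun n hn => ?_⟩
  · have hn0 : (0 : ℝ) < n := by exact_mod_cast hn
    refine ⟨1 / (n : ℝ) ^ n, by positivity, fun m k _ _ hk => ?_⟩
    have h := pow_le_factorial_mul_deepSetComplexity hn hk m
    calc _ = (m.prod : ℝ) ^ n / n.factorial := by field_simp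
      _ ≤ _ := by rwa [div_le_iff₀' (by positivity)]
  · have := hpos n hn
    exact ⟨_, by positivity, fun m k _ _ hk => hsecond n hn m k hk⟩
  · refine ⟨Real.exp (-1), 1, Real.exp_pos _, one_pos, fun n M hn => ⟨?_, ?_⟩⟩
    · rw [mul_pow, mul_div_assoc, mul_left_comm]
      exact mul_le_mul_of_nonneg_left (exp_mul_le_pow_div_factorial hn) (by positivity)
    · rw [mul_pow, mul_div_assoc, one_mul]
      exact mul_le_mul_of_nonneg_left (pow_div_factorial_le hn) (by positivity)
  · have hn0 : (0 : ℝ) < n := by exact_mod_cast hn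
    have hb := hpos n hn
    refine ⟨1 / (n.factorial * (Real.exp 1 ^ n / √(n : ℝ))),
      (n + 1) * (n : ℝ) ^ n / (Real.exp 1 ^ n / √(n : ℝ)), by positivity, by positivity,
      fun m k hm hm1 hk => ⟨?_, ?_⟩⟩
    -- The shallow lower bound is the general one for a one-entry list, whose product is `m.sum`.
    · simpa using hsecond n hn [m.sum] k hk
    · refine (toNat_deepSetComplexity_singleton_le hn (List.one_le_sum hm hm1) k).trans_eq ?_
      have : 0 < √(n : ℝ) := Real.sqrt_pos.2 hn0
      rw [mul_pow]
      field_simp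
  · have hn0 : (0 : ℝ) < n := by exact_mod_cast hn
    refine ⟨_, by positivity, fun m k hm hm1 hk => ⟨hratio n hn m k hm hm1 hk, fun w _ hmw => ?_⟩⟩
    refine le_trans ?_ (hratio n hn m k hm hm1 hk)
    have hs0 : (0 : ℝ) < m.sum := by exact_mod_cast List.one_le_sum hm hm1
    have hl0 : (0 : ℝ) < m.length := by exact_mod_cast List.length_pos_iff.2 hm
    have hle : (w : ℝ) ^ (m.length - 1) / (m.length : ℝ) ≤ (m.prod : ℝ) / (m.sum : ℝ) := by
      rw [div_le_div_iff₀ hl0 hs0, mul_comm (m.prod : ℝ)]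
      exact_mod_cast List.pow_length_mul_sum_le hmw
    gcongr
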